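/- Let $(M^n,g)$ be a Hermitian manifold of complex dimension $n$, not necessarily compact, and write $g_{i\bar j}$ for the components of $g$ in local holomorphic coordinates. Let $$R_{i\bar jk\bar l}=-\frac{\partial^2 g_{k\bar l}}{\partial z^i\partial\bar z^j}+g^{p\bar q}\frac{\partial g_{k\bar q}}{\partial z^i}\frac{\partial g_{p\bar l}}{\partial\bar z^j}$$ be the curvature tensor of the Chern connection, let $Ric=-\sqrt{-1}\,\partial\bar\partial\log\det g$ be the first Chern Ricci curvature, with components $R_{i\bar j}=-\partial_i\partial_{\bar j}\log\det g$, and let $H(X)=R(X,\overline X,X,\overline X)/|X|^4$ be the holomorphic sectional curvature. For $\alpha,\beta\in\mathbb{R}$ the mixed curvature of a nonzero $(1,0)$-vector $X$ is $$\mathcal{C}_{\alpha,\beta}(X)=\frac{\alpha}{|X|_g^2}\,Ric(X,\overline X)+\beta\,H(X).$$ Assume that $g$ is Chern Kähler-like, i.e. $R_{i\bar jk\bar l}=R_{k\bar ji\bar l}=R_{i\bar lk\bar j}$ everywhere, and that there is a real constant $c\neq0$ with $\mathcal{C}_{\alpha,\beta}(X)=c$ for every point of $M$ and every nonzero $(1,0)$-vector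 $X$ there. If $(n+2)\alpha+4\beta\neq0$, then $g$ is Kähler, i.e. its Kähler form $\omega=\sqrt{-1}\sum_{i,j} g_{i\bar j}\,dz^i\wedge d\bar z^j$ is closed. -/

import Mathlib

open scoped Manifold ContDiff ComplexConjugate

noncomputable section

namespace HermitianGeometry

/-- The complex coordinate space in which the charts of an `n`-dimensional complex manifold take
their values. -/
abbrev Model (n : ℕ) : Type := EuclideanSpace ℂ (Fin n)

/-! ### Calculus in complex coordinates -/

/-- The `i`-th standard basis vector of the coordinate space. -/
def basisVec {n : ℕ} (i : Fin n) : Model n := EuclideanSpace.single i (1 : ℂ)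

/-- The Wirtinger derivative `∂f/∂zⁱ = (∂f/∂xⁱ - √-1 ∂f/∂yⁱ)/2`, where `zⁱ = xⁱ + √-1 yⁱ`. -/
def delZ {n : ℕ} (i : Fin n) (f : Model n → ℂ) (z : Model n) : ℂ :=
  (fderiv ℝ f z (basisVec i) - Complex.I * fderiv ℝ f z (Complex.I • basisVec i)) / 2

/-- The Wirtinger derivative `∂f/∂z̄ⁱ = (∂f/∂xⁱ + √-1 ∂f/∂yⁱ)/2`. -/
def delZbar {n : ℕ} (i : Fin n) (f : Model n → ℂ) (z : Model n) : ℂ :=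
  (fderiv ℝ f z (basisVec i) + Complex.I * fderiv ℝ f z (Complex.I • basisVec i)) / 2

/-- The one-form `dzⁱ`, as a real-linear map with values in `ℂ`. -/
def coordForm {n : ℕ} (i : Fin n) : Model n →L[ℝ] ℂ :=
  (EuclideanSpace.proj i : Model n →L[ℂ] ℂ).restrictScalars ℝ

/-- The one-form `dz̄ⁱ`. -/
def coordFormBar {n : ℕ} (i : Fin n) : Model n →L[ℝ] ℂ :=
  (Complex.conjCLE : ℂ →L[ℝ] ℂ).comp (coordForm i)

/-- The wedge product `a ∧ b` of two complex-valued one-forms. -/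
def wedge {n : ℕ} (a b : Model n →L[ℝ] ℂ) : Model n [⋀^Fin 2]→L[ℝ] ℂ :=
  ContinuousMultilinearMap.alternatization
    ((ContinuousMultilinearMap.mkPiAlgebra ℝ (Fin 2) ℂ).compContinuousLinearMap ![a, b])

theorem wedge_apply {n : ℕ} (a b : Model n →L[ℝ] ℂ) (v : Fin 2 → Model n) :
    wedge a b v = a (v 0) * b (v 1) - a (v 1) * b (v 0) := by
  have h : (Finset.univ : Finset (Equiv.Perm (Fin 2))) = {1, Equiv.swap 0 1} := by decide
  have h' : (1 : Equiv.Perm (Fin 2)) ≠ Equiv.swap 0 1 := by decide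
  simp [wedge, ContinuousMultilinearMap.alternatization_apply_apply, Fin.prod_univ_two, h,
    Finset.sum_pair h', sub_eq_add_neg]

/-! ### Hermitian metrics on complex manifolds -/

section Manifold

variable {n : ℕ} {M : Type*} [TopologicalSpace M] [ChartedSpace (Model n) M]

variable (n M) in
/-- The local holomorphic charts of the complex manifold `M`. -/
def holomorphicCharts : Set (OpenPartialHomeomorph M (Model n)) :=
  IsManifold.maximalAtlas 𝓘(ℂ, Model n) ω M

/-- The coordinate vector field `∂/∂zᵏ` of the chart `e`, at the point with coordinates `z`.
The holomorphic tangent space `T^{1,0}` is the complex vector space `TangentSpace 𝓘(ℂ, _)`. -/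
def coordVector (e : OpenPartialHomeomorph M (Model n)) (z : Model n) (k : Fin n) :
    TangentSpace 𝓘(ℂ, Model n) (e.symm z) :=
  mfderiv 𝓘(ℂ, Model n) 𝓘(ℂ, Model n) e.symm z (basisVec k)

variable (n M) in
/-- A smooth Hermitian metric on the complex manifold `M`: a positive definite Hermitian form on
every holomorphic tangent space (linear in the first variable and conjugate-linear in the second),
whose coefficients in every local holomorphic chart are smooth in the real sense. -/
structure HermitianMetric where
  form : ∀ p : M, TangentSpace 𝓘(ℂ, Model n) p →ₗ[ℂ]
    TangentSpace 𝓘(ℂ, Model n) p →ₗ⋆[ℂ] ℂ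
  conj_symm : ∀ (p : M) (u v : TangentSpace 𝓘(ℂ, Model n) p), conj (form p v u) = form p u v
  pos : ∀ (p : M) (v : TangentSpace 𝓘(ℂ, Model n) p), v ≠ 0 → 0 < (form p v v).re
  smooth : ∀ e ∈ holomorphicCharts n M, ∀ k l : Fin n,
    ContDiffOn ℝ ∞ (fun z => form (e.symm z) (coordVector e z k) (coordVector e z l)) e.target

namespace HermitianMetric

variable (g : HermitianMetric n M) (e : OpenPartialHomeomorph M (Model n))

/-- The matrix `(g_{k l̄})` of the metric in the chart `e`, as a function of the coordinates. -/
def coeff (z : Model n) : Matrix (Fin n) (Fin n) ℂ :=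
  Matrix.of fun k l => g.form (e.symm z) (coordVector e z k) (coordVector e z l)

/-- The coefficients `g^{p q̄}` of the inverse matrix, normalized by
`∑ₚ g^{p q̄} g_{p l̄} = δ_{q l}`. -/
def invCoeff (z : Model n) (p q : Fin n) : ℂ := (g.coeff e z)⁻¹ q p

/-- The components of the curvature tensor of the Chern connection in the holomorphic chart `e`,
`R_{i j̄ k l̄} = - ∂²g_{k l̄}/∂zⁱ∂z̄ʲ + g^{p q̄} (∂g_{k q̄}/∂zⁱ) (∂g_{p l̄}/∂z̄ʲ)`. -/
def chernCurvature (z : Model n) (i j k l : Fin n) : ℂ :=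
  - delZ i (delZbar j fun w => g.coeff e w k l) z
    + ∑ p, ∑ q, g.invCoeff e z p q *
        (delZ i (fun w => g.coeff e w k q) z * delZbar j (fun w => g.coeff e w p l) z)

/-- The components of the first Chern Ricci curvature `Ric = -√-1 ∂∂̄ log det g`,
`R_{i j̄} = - ∂² log det g/∂zⁱ∂z̄ʲ`. (The determinant is a positive real number, and so the
principal branch of the logarithm is the real logarithm.) -/
def chernRicci (z : Model n) (i j : Fin n) : ℂ :=
  - delZ i (delZbar j fun w => Complex.log (g.coeff e w).det) z

/-- `|X|² = g_{i j̄} Xⁱ X̄ʲ` for the vector `X = ∑ Xⁱ ∂/∂zⁱ` of type `(1,0)`. -/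
def normSq (z : Model n) (X : Fin n → ℂ) : ℂ :=
  ∑ i, ∑ j, g.coeff e z i j * X i * conj (X j)

/-- The holomorphic sectional curvature `H(X) = R(X, X̄, X, X̄) / |X|⁴`. -/
def holSectional (z : Model n) (X : Fin n → ℂ) : ℂ :=
  (∑ i, ∑ j, ∑ k, ∑ l,
    g.chernCurvature e z i j k l * X i * conj (X j) * X k * conj (X l)) / g.normSq e z X ^ 2

/-- The mixed curvature `𝒞_{α,β}(X) = (α / |X|²) Ric(X, X̄) + β H(X)`. -/
def mixedCurvature (α β : ℝ) (z : Model n) (X : Fin n → ℂ) : ℂ :=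
  (α : ℂ) / g.normSq e z X * (∑ i, ∑ j, g.chernRicci e z i j * X i * conj (X j))
    + (β : ℂ) * g.holSectional e z X

/-- The Kähler form `√-1 ∑ g_{i j̄} dzⁱ ∧ dz̄ʲ` of the metric in the chart `e`. -/
def kahlerForm (z : Model n) : Model n [⋀^Fin 2]→L[ℝ] ℂ :=
  ∑ i, ∑ j, (Complex.I * g.coeff e z i j) • wedge (coordForm i) (coordFormBar j)

/-- The mixed curvature `𝒞_{α,β}` is equal to `c` at every point and on every nonzero vector of
type `(1,0)`. -/
def HasConstantMixedCurvature (α β c : ℝ) : Prop :=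
  ∀ e ∈ holomorphicCharts n M, ∀ z ∈ e.target, ∀ X : Fin n → ℂ, X ≠ 0 →
    g.mixedCurvature e α β z X = (c : ℂ)

/-- The metric is Chern Kähler-like: the Chern curvature tensor has the symmetries of the
curvature tensor of a Kähler metric. -/
def IsKahlerLike : Prop :=
  ∀ e ∈ holomorphicCharts n M, ∀ z ∈ e.target, ∀ i j k l : Fin n,
    g.chernCurvature e z i j k l = g.chernCurvature e z k j i l ∧
    g.chernCurvature e z i j k l = g.chernCurvature e z i l k j

/-- The metric is Kähler: its Kähler form is closed. -/
def IsKahler : Prop :=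
  ∀ e ∈ holomorphicCharts n M, ∀ z ∈ e.target, extDeriv (g.kahlerForm e) z = 0

end HermitianMetric

end Manifold

end HermitianGeometry

end

/-! The constant mixed curvature condition forces the metric to be Einstein with nonzero constant,
and a metric proportional to its own first Chern Ricci form is closed because `-∂∂̄ log det g` is.

Clearing denominators, the hypothesis equates two quartic forms in `X`. The Kähler-like symmetries
allow polarization (`eq_zero_of_quarticForm_diag`), giving a tensor identity between `R`, `Ric ⊗ g`
and `g ⊗ g` (`polarized_mixedCurvature`). For every Hermitian metric the trace of `R` over its last
two indices is the first Chern Ricci curvature (`chernRicci_eq_trace`, from Jacobi's formula).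
Contracting therefore gives `((n+2)α + 4β) Ric = (2c(n+1) - αs) g`, with `s` the trace of `Ric`, so
`Ric = μ g` pointwise. A second trace gives `s = nμ` and `(2(n+1)α + 4β) μ = 2c(n+1) ≠ 0`: thus `μ`
is a nonzero constant, and no Schur-type argument is needed. -/

namespace HermitianGeometry

/-! ### Wirtinger calculus and second derivatives of `log det`. -/

section Wirtinger

variable {E : Type*} [NormedAddCommGroup E] [NormedSpace ℂ E]

/-- The first-order operator `f ↦ (df(v) + a df(√-1 v)) / 2`; it is the Wirtinger derivative
`∂/∂z` in the direction `v` for `a = -√-1`, and `∂/∂z̄` for `a = √-1`. -/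
noncomputable def wirt (a : ℂ) (v : E) (f : E → ℂ) (z : E) : ℂ :=
  (fderiv ℝ f z v + a * fderiv ℝ f z (Complex.I • v)) / 2

variable {a b : ℂ} {v w : E} {f g : E → ℂ} {z : E} {U : Set E}

theorem delZ_eq_wirt {n : ℕ} (i : Fin n) : delZ i = wirt (-Complex.I) (basisVec i) := by
  ext f z; simp only [delZ, wirt]; ring

theorem delZbar_eq_wirt {n : ℕ} (i : Fin n) : delZbar i = wirt Complex.I (basisVec i) := rfl

theorem wirt_congr (hU : IsOpen U) (hz : z ∈ U) (h : Set.EqOn f g U) :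
    wirt a v f z = wirt a v g z := by
  have : f =ᶠ[nhds z] g := Filter.eventuallyEq_of_mem (hU.mem_nhds hz) h
  simp only [wirt, this.fderiv_eq]

theorem wirt_const (c : ℂ) : wirt a v (fun _ => c) z = 0 := by
  simp [wirt]

theorem wirt_sum {ι : Type*} (s : Finset ι) {F : ι → E → ℂ}
    (hF : ∀ i ∈ s, DifferentiableAt ℝ (F i) z) :
    wirt a v (fun w => ∑ i ∈ s, F i w) z = ∑ i ∈ s, wirt a v (F i) z := by
  simp only [wirt, fderiv_fun_sum hF, _root_.sum_apply, Finset.mul_sum,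
    ← Finset.sum_add_distrib, Finset.sum_div]

theorem wirt_mul (hf : DifferentiableAt ℝ f z) (hg : DifferentiableAt ℝ g z) :
    wirt a v (fun w => f w * g w) z = wirt a v f z * g z + f z * wirt a v g z := by
  simp only [wirt, fderiv_fun_mul hf hg, _root_.add_apply,
    _root_.smul_apply, smul_eq_mul]
  ring

theorem wirt_const_mul (c : ℂ) (hf : DifferentiableAt ℝ f z) :
    wirt a v (fun w => c * f w) z = c * wirt a v f z := by
  rw [wirt_mul (differentiableAt_const c) hf, wirt_const]; ring

theorem wirt_prod {ι : Type*} [DecidableEq ι] (s : Finset ι) {F : ι → E → ℂ}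
    (hF : ∀ i ∈ s, DifferentiableAt ℝ (F i) z) :
    wirt a v (fun w => ∏ i ∈ s, F i w) z
      = ∑ i ∈ s, (∏ j ∈ s.erase i, F j z) * wirt a v (F i) z := by
  have h := (HasFDerivAt.finsetProd fun i hi => (hF i hi).hasFDerivAt).fderiv
  simp only [wirt, h, _root_.sum_apply, _root_.smul_apply, smul_eq_mul,
    Finset.mul_sum, ← Finset.sum_add_distrib, Finset.sum_div]
  exact Finset.sum_congr rfl fun i _ => by ring

theorem wirt_log (hf : DifferentiableAt ℝ f z) (h : f z ∈ Complex.slitPlane) :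
    wirt a v (fun w => Complex.log (f w)) z = (f z)⁻¹ * wirt a v f z := by
  have h' := ((((Complex.hasStrictDerivAt_log h).hasDerivAt.hasFDerivAt.restrictScalars ℝ).comp z
    hf.hasFDerivAt).congr_of_eventuallyEq (f₁ := fun w => Complex.log (f w)) .rfl).fderiv
  simp only [wirt, h', ContinuousLinearMap.comp_apply, ContinuousLinearMap.coe_restrictScalars',
    ContinuousLinearMap.toSpanSingleton_apply, smul_eq_mul]
  ring

theorem contDiffOn_wirt (hU : IsOpen U) (hf : ContDiffOn ℝ ∞ f U) :
    ContDiffOn ℝ ∞ (wirt a v f) U := by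
  have h := hf.fderiv_of_isOpen (m := ∞) hU (by simp)
  have h1 (u : E) : ContDiffOn ℝ ∞ (fun z => fderiv ℝ f z u) U := h.clm_apply contDiffOn_const
  exact ((h1 v).add (contDiffOn_const.mul (h1 _))).div_const 2

/-- Both operators are constant-coefficient combinations of real directional derivatives, so the
symmetry of the second real derivative suffices. Free `a` and `b` cover the pure and the mixed cases
at once. -/
theorem wirt_comm (hU : IsOpen U) (hf : ContDiffOn ℝ ∞ f U) (hz : z ∈ U) :
    wirt a v (wirt b w f) z = wirt b w (wirt a v f) z := by
  have h := (hf.fderiv_of_isOpen (m := ∞) hU (by simp)).contDiffAt (hU.mem_nhds hz)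
  have hd : DifferentiableAt ℝ (fderiv ℝ f) z := h.differentiableAt (by simp)
  have hs : IsSymmSndFDerivAt ℝ f z :=
    (hf.contDiffAt (hU.mem_nhds hz)).isSymmSndFDerivAt (by simpa using ENat.LEInfty.out)
  have key (c : ℂ) (x u : E) : fderiv ℝ (wirt c x f) z u
      = (fderiv ℝ (fderiv ℝ f) z u x + c * fderiv ℝ (fderiv ℝ f) z u (Complex.I • x)) / 2 := by
    have e (y : E) : HasFDerivAt (fun p => fderiv ℝ f p y)
        ((fderiv ℝ (fderiv ℝ f) z).flip y) z := by
      simpa using hd.hasFDerivAt.clm_apply (hasFDerivAt_const y z)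
    have e2 := ((e x).add ((e (Complex.I • x)).const_mul c)).mul_const (2⁻¹ : ℂ)
    have e3 : HasFDerivAt (wirt c x f) _ z := e2
    rw [e3.fderiv]
    simp
    ring
  simp only [wirt.eq_def _ _ (wirt _ _ f), key]
  rw [hs v w, hs v (Complex.I • w), hs (Complex.I • v) w, hs (Complex.I • v) (Complex.I • w)]
  ring

/-- **Jacobi's formula** for the derivative of a determinant. -/
theorem wirt_det {n : ℕ} {G : E → Matrix (Fin n) (Fin n) ℂ}
    (hG : ∀ i j, DifferentiableAt ℝ (fun w => G w i j) z) :
    wirt a v (fun w => (G w).det) z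
      = ∑ k, ∑ l, (G z).adjugate l k * wirt a v (fun w => G w k l) z := by
  simp only [Matrix.det_apply']
  have hp (σ : Equiv.Perm (Fin n)) : DifferentiableAt ℝ (fun w => ∏ i, G w (σ i) i) z :=
    (HasFDerivAt.finsetProd fun i _ => (hG (σ i) i).hasFDerivAt).differentiableAt
  rw [wirt_sum _ fun σ _ => (hp σ).const_mul _]
  simp only [wirt_const_mul _ (hp _),
    wirt_prod _ fun i _ => hG _ i]
  -- By Cramer's rule, the terms for a fixed `l` add up to the determinant with column `l`
  -- differentiated.
  have hadj (l : Fin n) : ∑ k, (G z).adjugate l k * wirt a v (fun w => G w k l) z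
      = ((G z).updateCol l fun k => wirt a v (fun w => G w k l) z).det := by
    rw [← Matrix.cramer_apply, Matrix.cramer_eq_adjugate_mulVec]
    rfl
  rw [Finset.sum_comm (f := fun k l => (G z).adjugate l k * wirt a v (fun w => G w k l) z)]
  simp only [hadj, Matrix.det_apply', Finset.mul_sum]
  rw [Finset.sum_comm]
  refine Finset.sum_congr rfl fun l _ => Finset.sum_congr rfl fun σ _ => ?_
  rw [← Finset.prod_erase_mul _ _ (Finset.mem_univ l)]
  congr 1
  rw [Matrix.updateCol_self]
  congr 1
  refine Finset.prod_congr rfl fun j hj => ?_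
  rw [Matrix.updateCol_ne (Finset.ne_of_mem_erase hj)]

theorem contDiffOn_det {n : ℕ} {G : E → Matrix (Fin n) (Fin n) ℂ}
    (hG : ∀ i j, ContDiffOn ℝ ∞ (fun w => G w i j) U) :
    ContDiffOn ℝ ∞ (fun w => (G w).det) U := by
  simp only [Matrix.det_apply']
  exact ContDiffOn.sum fun σ _ => contDiffOn_const.mul (contDiffOn_prod fun i _ => hG _ _)

theorem contDiffOn_inv_entry {n : ℕ} {G : E → Matrix (Fin n) (Fin n) ℂ}
    (hG : ∀ i j, ContDiffOn ℝ ∞ (fun w => G w i j) U) (hdet : ∀ w ∈ U, (G w).det ≠ 0)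
    (k l : Fin n) : ContDiffOn ℝ ∞ (fun w => (G w)⁻¹ k l) U := by
  simp only [Matrix.inv_def, Ring.inverse_eq_inv', Matrix.smul_apply, smul_eq_mul,
    Matrix.adjugate_apply]
  refine ((contDiffOn_det hG).inv hdet).mul (contDiffOn_det fun i j => ?_)
  by_cases h : i = l
  · subst h; simpa using contDiffOn_const
  · simpa [Matrix.updateRow_ne h] using hG i j

/-- The second logarithmic derivatives of the determinant of a matrix-valued function. -/
theorem wirt_wirt_log_det {n : ℕ} {G : E → Matrix (Fin n) (Fin n) ℂ} (hU : IsOpen U)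
    (hG : ∀ i j, ContDiffOn ℝ ∞ (fun w => G w i j) U)
    (hdet : ∀ w ∈ U, (G w).det ∈ Complex.slitPlane) (hz : z ∈ U) :
    wirt a v (wirt b w fun x => Complex.log (G x).det) z
      = ∑ k, ∑ l, (G z)⁻¹ l k * (wirt a v (wirt b w fun x => G x k l) z
          - ∑ p, ∑ q, (G z)⁻¹ q p *
            (wirt a v (fun x => G x k q) z * wirt b w (fun x => G x p l) z)) := by
  have hd0 : ∀ x ∈ U, (G x).det ≠ 0 := fun x hx => Complex.slitPlane_ne_zero (hdet x hx)
  have diff {f : E → ℂ} (hf : ContDiffOn ℝ ∞ f U) {x : E} (hx : x ∈ U) :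
      DifferentiableAt ℝ f x :=
    (hf.contDiffAt (hU.mem_nhds hx)).differentiableAt (by simp)
  have hI := contDiffOn_inv_entry hG hd0
  -- The first derivative is `tr(G⁻¹ ∂G)`; it is needed on all of `U` so that it can be
  -- differentiated again.
  have h1 : Set.EqOn (wirt b w fun x => Complex.log (G x).det)
      (fun x => ∑ k, ∑ l, (G x)⁻¹ l k * wirt b w (fun y => G y k l) x) U := by
    intro x hx
    simp only
    rw [wirt_log (diff (contDiffOn_det hG) hx) (hdet x hx), wirt_det fun i j => diff (hG i j) hx]
    simp only [Finset.mul_sum, Matrix.inv_def, Ring.inverse_eq_inv', Matrix.smul_apply,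
      smul_eq_mul, mul_assoc]
  have hI' (k l : Fin n) : DifferentiableAt ℝ (fun x => (G x)⁻¹ k l) z := diff (hI k l) hz
  have hG' (k l : Fin n) : DifferentiableAt ℝ (fun x => G x k l) z := diff (hG k l) hz
  have hB (k l : Fin n) := contDiffOn_wirt (a := b) (v := w) hU (hG k l)
  have hB' (k l : Fin n) : DifferentiableAt ℝ (fun x => wirt b w (fun y => G y k l) x) z :=
    diff (hB k l) hz
  rw [wirt_congr hU hz h1, wirt_sum _ fun k _ => DifferentiableAt.fun_sum fun l _ =>
    (hI' l k).fun_mul (hB' k l)]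
  simp only [wirt_sum _ fun l _ => (hI' l _).fun_mul (hB' _ l), wirt_mul (hI' _ _) (hB' _ _)]
  -- the derivative of the inverse matrix
  set A : Matrix (Fin n) (Fin n) ℂ := Matrix.of fun i j => wirt a v (fun x => G x i j) z
  set B : Matrix (Fin n) (Fin n) ℂ := Matrix.of fun i j => wirt b w (fun x => G x i j) z
  set D : Matrix (Fin n) (Fin n) ℂ := Matrix.of fun i j => wirt a v (fun x => (G x)⁻¹ i j) z
  have hunit : IsUnit (G z).det := (hd0 z hz).isUnit
  -- Differentiate `G⁻¹ G = 1`.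
  have hDG : D * G z + (G z)⁻¹ * A = 0 := by
    ext i j
    have h2 : wirt a v (fun x => ∑ m, (G x)⁻¹ i m * G x m j) z = 0 := by
      rw [wirt_congr (g := fun _ => (1 : Matrix (Fin n) (Fin n) ℂ) i j) hU hz, wirt_const]
      intro x hx
      simp only
      rw [← Matrix.mul_apply, Matrix.nonsing_inv_mul _ (hd0 x hx).isUnit]
    rw [wirt_sum _ fun m _ => (hI' _ _).fun_mul (hG' _ _)] at h2
    simp only [wirt_mul (hI' _ _) (hG' _ _), Finset.sum_add_distrib] at h2
    exact h2
  have hD : D = -((G z)⁻¹ * A * (G z)⁻¹) := by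
    have h3 := congrArg (· * (G z)⁻¹) (eq_neg_of_add_eq_zero_left hDG)
    simpa [Matrix.mul_assoc, Matrix.mul_nonsing_inv _ hunit] using h3
  have h4 : ∑ k, ∑ l, D l k * B k l
      = -∑ k, ∑ l, (G z)⁻¹ l k * ∑ p, ∑ q, (G z)⁻¹ q p * (A k q * B p l) := by
    have h5 : ∑ k, ∑ l, D l k * B k l = (D * B).trace := by
      simp only [Matrix.trace, Matrix.diag, Matrix.mul_apply]
      exact Finset.sum_comm
    have h6 : ∑ k, ∑ l, (G z)⁻¹ l k * ∑ p, ∑ q, (G z)⁻¹ q p * (A k q * B p l)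
        = ((G z)⁻¹ * (A * ((G z)⁻¹ * B))).trace := by
      simp only [Matrix.trace, Matrix.diag, Matrix.mul_apply]
      rw [Finset.sum_comm]
      refine Finset.sum_congr rfl fun l _ => Finset.sum_congr rfl fun k _ => ?_
      congr 1
      rw [Finset.sum_comm]
      simp only [Finset.mul_sum]
      exact Finset.sum_congr rfl fun q _ => Finset.sum_congr rfl fun p _ => by ring
    rw [h5, h6, hD, Matrix.neg_mul, Matrix.trace_neg, Matrix.mul_assoc, Matrix.mul_assoc]
  simp only [Finset.sum_add_distrib, mul_sub, Finset.sum_sub_distrib]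
  simp only [A, B, D, Matrix.of_apply] at h4
  rw [h4]
  ring

end Wirtinger

/-! ### Polarization of quartic forms with Kähler symmetries. -/

section Polarization

/-- A polynomial of degree four without constant term which vanishes identically on `ℝ` has vanishing
linear coefficient. -/
theorem linear_coeff_eq_zero {c₁ c₂ c₃ c₄ : ℂ}
    (h : ∀ t : ℝ, (t : ℂ) * c₁ + t ^ 2 * c₂ + t ^ 3 * c₃ + t ^ 4 * c₄ = 0) : c₁ = 0 := by
  have h1 := h 1
  have h2 := h (-1)
  have h3 := h 2
  have h4 := h (-2)
  push_cast at h1 h2 h3 h4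
  -- Five-point central difference: the even coefficients cancel in each difference, and the weights
  -- eliminate `c₃`.
  linear_combination (2 / 3) * (h1 - h2) - (1 / 12) * (h3 - h4)

variable {n : ℕ}

/-- The form `∑ T_{i j̄ k l̄} Xⁱ Ȳʲ Zᵏ W̄ˡ`. -/
noncomputable def quarticForm (T : Fin n → Fin n → Fin n → Fin n → ℂ) (X Y Z W : Fin n → ℂ) : ℂ :=
  ∑ i, ∑ j, ∑ k, ∑ l, T i j k l * X i * conj (Y j) * Z k * conj (W l)

variable (T : Fin n → Fin n → Fin n → Fin n → ℂ)

theorem quarticForm_swap₁₃ (X Y Z W : Fin n → ℂ) :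
    quarticForm T X Y Z W = quarticForm (fun i j k l => T k j i l) Z Y X W := by
  simp only [quarticForm]
  rw [Finset.sum_comm]
  conv_lhs => enter [2, j]; rw [Finset.sum_comm]
  rw [Finset.sum_comm]
  refine Finset.sum_congr rfl fun k _ => Finset.sum_congr rfl fun j _ =>
    Finset.sum_congr rfl fun i _ => Finset.sum_congr rfl fun l _ => by ring

theorem quarticForm_swap₂₄ (X Y Z W : Fin n → ℂ) :
    quarticForm T X Y Z W = quarticForm (fun i j k l => T i l k j) X W Z Y := by
  simp only [quarticForm]
  refine Finset.sum_congr rfl fun i _ => ?_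
  rw [Finset.sum_comm]
  conv_lhs => enter [2, k]; rw [Finset.sum_comm]
  rw [Finset.sum_comm]
  refine Finset.sum_congr rfl fun k _ => Finset.sum_congr rfl fun j _ =>
    Finset.sum_congr rfl fun i _ => by ring

theorem quarticForm_add₁ (X X' Y Z W : Fin n → ℂ) :
    quarticForm T (X + X') Y Z W = quarticForm T X Y Z W + quarticForm T X' Y Z W := by
  simp only [quarticForm, ← Finset.sum_add_distrib, Pi.add_apply, mul_add, add_mul]

theorem quarticForm_add₂ (X Y Y' Z W : Fin n → ℂ) :
    quarticForm T X (Y + Y') Z W = quarticForm T X Y Z W + quarticForm T X Y' Z W := by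
  simp only [quarticForm, ← Finset.sum_add_distrib, Pi.add_apply, map_add, mul_add, add_mul]

theorem quarticForm_smul₁ (t : ℂ) (X Y Z W : Fin n → ℂ) :
    quarticForm T (t • X) Y Z W = t * quarticForm T X Y Z W := by
  simp only [quarticForm, Finset.mul_sum, Pi.smul_apply, smul_eq_mul]
  refine Finset.sum_congr rfl fun i _ => Finset.sum_congr rfl fun j _ =>
    Finset.sum_congr rfl fun k _ => Finset.sum_congr rfl fun l _ => by ring

theorem quarticForm_smul₂ (t : ℂ) (X Y Z W : Fin n → ℂ) :
    quarticForm T X (t • Y) Z W = conj t * quarticForm T X Y Z W := by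
  simp only [quarticForm, Finset.mul_sum, Pi.smul_apply, smul_eq_mul, map_mul]
  refine Finset.sum_congr rfl fun i _ => Finset.sum_congr rfl fun j _ =>
    Finset.sum_congr rfl fun k _ => Finset.sum_congr rfl fun l _ => by ring

theorem quarticForm_single (i j k l : Fin n) :
    quarticForm T (Pi.single i 1) (Pi.single j 1) (Pi.single k 1) (Pi.single l 1) = T i j k l := by
  have h (j m : Fin n) : conj ((Pi.single j 1 : Fin n → ℂ) m) = if m = j then 1 else 0 := by
    rw [Pi.single_apply]; split_ifs <;> simp
  simp only [quarticForm, h]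
  simp [Pi.single_apply]

variable {T}

/-- **Polarization**: a tensor with the Kähler symmetries is determined by its values on the
diagonal. -/
theorem eq_zero_of_quarticForm_diag (h₁₃ : ∀ i j k l, T i j k l = T k j i l)
    (h₂₄ : ∀ i j k l, T i j k l = T i l k j) (h : ∀ X, quarticForm T X X X X = 0)
    (i j k l : Fin n) : T i j k l = 0 := by
  -- The two symmetries carry linearity in slots 1 and 2 over to slots 3 and 4.
  have s₁₃ (X Y Z W) : quarticForm T X Y Z W = quarticForm T Z Y X W := by
    rw [quarticForm_swap₁₃]; simp only [← h₁₃]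
  have s₂₄ (X Y Z W) : quarticForm T X Y Z W = quarticForm T X W Z Y := by
    rw [quarticForm_swap₂₄]; simp only [← h₂₄]
  have a₃ (X Y Z Z' W) : quarticForm T X Y (Z + Z') W
      = quarticForm T X Y Z W + quarticForm T X Y Z' W := by
    rw [s₁₃, quarticForm_add₁, s₁₃ Z, s₁₃ Z']
  have a₄ (X Y Z W W') : quarticForm T X Y Z (W + W')
      = quarticForm T X Y Z W + quarticForm T X Y Z W' := by
    rw [s₂₄, quarticForm_add₂, s₂₄ X W, s₂₄ X W']
  have m₃ (t : ℂ) (X Y Z W) : quarticForm T X Y (t • Z) W = t * quarticForm T X Y Z W := by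
    rw [s₁₃, quarticForm_smul₁, s₁₃ Z]
  have m₄ (t : ℂ) (X Y Z W) : quarticForm T X Y Z (t • W) = conj t * quarticForm T X Y Z W := by
    rw [s₂₄, quarticForm_smul₂, s₂₄ X W]
  -- The part of `h (X + tY)` linear in `t` gives the sum of a term linear and a term
  -- conjugate-linear in `Y`; replacing `Y` by `√-1 Y` separates them. The next two steps repeat
  -- this device, freeing one more slot each time.
  have first (X Y) : quarticForm T Y X X X = 0 := by
    have lin (Y) : quarticForm T Y X X X + quarticForm T X Y X X = 0 := by
      have := linear_coeff_eq_zero (c₁ := 2 * (quarticForm T Y X X X + quarticForm T X Y X X))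
        (c₂ := quarticForm T Y X Y X + quarticForm T X Y X Y + 4 * quarticForm T Y Y X X)
        (c₃ := 2 * (quarticForm T Y Y Y X + quarticForm T Y Y X Y))
        (c₄ := quarticForm T Y Y Y Y) fun t => by
          have e := h (X + (t : ℂ) • Y)
          simp only [quarticForm_add₁, quarticForm_add₂, a₃, a₄, quarticForm_smul₁,
            quarticForm_smul₂, m₃, m₄, Complex.conj_ofReal] at e
          rw [s₁₃ X X Y X, s₂₄ X X X Y, s₁₃ X Y Y X, s₂₄ Y X X Y, s₁₃ X X Y Y, s₂₄ Y X X Y,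
            s₁₃ X Y Y Y, s₂₄ Y X Y Y] at e
          linear_combination e - h X
      simpa using this
    have e1 := lin Y
    have e2 := lin (Complex.I • Y)
    rw [quarticForm_smul₁, quarticForm_smul₂, Complex.conj_I] at e2
    linear_combination (1 / 2) * e1 - (Complex.I / 2) * e2 +
      (1 / 2) * (quarticForm T Y X X X - quarticForm T X Y X X) * Complex.I_sq
  have second (X Y Z) : quarticForm T Y Z X X = 0 := by
    have lin (Z) : quarticForm T Y Z X X + quarticForm T Y X Z X + quarticForm T Y X X Z = 0 :=
      linear_coeff_eq_zero
        (c₂ := quarticForm T Y Z Z X + quarticForm T Y X Z Z + quarticForm T Y Z X Z)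
        (c₃ := quarticForm T Y Z Z Z) (c₄ := 0) fun t => by
          have e := first (X + (t : ℂ) • Z) Y
          simp only [quarticForm_add₂, a₃, a₄, quarticForm_smul₂, m₃, m₄,
            Complex.conj_ofReal] at e
          linear_combination e - first X Y
    have e1 := lin Z
    have e2 := lin (Complex.I • Z)
    rw [m₃, m₄, quarticForm_smul₂, Complex.conj_I] at e2
    rw [s₂₄ Y X X Z] at e1 e2
    linear_combination (1 / 4) * e1 + (Complex.I / 4) * e2 +
      (1 / 4) * (2 * quarticForm T Y Z X X - quarticForm T Y X Z X) * Complex.I_sq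
  have third (X Y Z W) : quarticForm T Y Z W X = 0 := by
    -- Plain additivity suffices here: the pure terms vanish by `second`.
    have lin (W) : quarticForm T Y Z W X + quarticForm T Y Z X W = 0 := by
      have e := second (X + W) Y Z
      rw [a₃, a₄, a₄, second, second] at e
      linear_combination e
    have e1 := lin W
    have e2 := lin (Complex.I • W)
    rw [m₃, m₄, Complex.conj_I] at e2
    linear_combination (1 / 2) * e1 - (Complex.I / 2) * e2 +
      (1 / 2) * (quarticForm T Y Z W X - quarticForm T Y Z X W) * Complex.I_sq
  rw [← quarticForm_single T i j k l, third]

end Polarization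

/-! ### Positivity in coordinates, the Ricci trace and the Einstein condition. -/

section Metric

variable {n : ℕ} {M : Type*} [TopologicalSpace M] [ChartedSpace (Model n) M]
  {e : OpenPartialHomeomorph M (Model n)} {z : Model n}

/-- This makes the coordinate vectors independent, so that positivity of the form on tangent spaces
passes to the coefficient matrix. -/
theorem mfderiv_symm_injective [IsManifold 𝓘(ℂ, Model n) ω M] (he : e ∈ holomorphicCharts n M)
    (hz : z ∈ e.target) :
    Function.Injective (mfderiv 𝓘(ℂ, Model n) 𝓘(ℂ, Model n) e.symm z) := by
  have h : e.MDifferentiable 𝓘(ℂ, Model n) 𝓘(ℂ, Model n) :=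
    ⟨(contMDiffOn_of_mem_maximalAtlas he).mdifferentiableOn (by simp),
      (contMDiffOn_symm_of_mem_maximalAtlas he).mdifferentiableOn (by simp)⟩
  exact h.symm.mfderiv_injective hz

namespace HermitianMetric

variable (g : HermitianMetric n M)

theorem contDiffOn_coeff (he : e ∈ holomorphicCharts n M) (k l : Fin n) :
    ContDiffOn ℝ ∞ (fun w => g.coeff e w k l) e.target :=
  g.smooth e he k l

theorem normSq_eq_form (X : Fin n → ℂ) :
    g.normSq e z X = g.form (e.symm z) (∑ k, X k • coordVector e z k)
      (∑ k, X k • coordVector e z k) := by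
  simp only [map_sum, LinearMap.sum_apply, map_smul, LinearMap.smul_apply, map_smulₛₗ, smul_eq_mul,
    normSq, coeff, Matrix.of_apply, Finset.mul_sum]
  rw [Finset.sum_comm]
  exact Finset.sum_congr rfl fun i _ => Finset.sum_congr rfl fun j _ => by ring

open scoped ComplexOrder in
theorem normSq_pos [IsManifold 𝓘(ℂ, Model n) ω M] (he : e ∈ holomorphicCharts n M)
    (hz : z ∈ e.target) {X : Fin n → ℂ} (hX : X ≠ 0) : 0 < g.normSq e z X := by
  have hv : ∑ k, X k • coordVector e z k ≠ 0 := by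
    have hx : (∑ k, X k • basisVec k : Model n) = WithLp.toLp 2 X := by
      ext i
      simp [basisVec, Pi.single_apply]
    have h1 : ∑ k, X k • coordVector e z k
        = mfderiv 𝓘(ℂ, Model n) 𝓘(ℂ, Model n) e.symm z (WithLp.toLp 2 X : Model n) := by
      rw [← hx]
      refine Eq.trans ?_ (map_sum _ _ _).symm
      exact Finset.sum_congr rfl fun k _ => (map_smul _ _ _).symm
    rw [h1]
    intro h0
    have h2 : (WithLp.toLp 2 X : Model n) = 0 :=
      mfderiv_symm_injective he hz (h0.trans (map_zero _).symm)
    exact hX (by simpa using h2)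
  rw [normSq_eq_form, Complex.lt_def]
  refine ⟨by simpa using g.pos _ _ hv, ?_⟩
  exact (Complex.conj_eq_iff_im.1 (g.conj_symm _ _ _)).symm

theorem coeff_conj (k l : Fin n) : conj (g.coeff e z l k) = g.coeff e z k l :=
  g.conj_symm _ _ _

open scoped ComplexOrder in
theorem posDef_coeff [IsManifold 𝓘(ℂ, Model n) ω M] (he : e ∈ holomorphicCharts n M)
    (hz : z ∈ e.target) : (g.coeff e z).PosDef := by
  refine Matrix.PosDef.of_dotProduct_mulVec_pos (Matrix.IsHermitian.ext fun k l => ?_) fun x hx => ?_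
  · exact g.coeff_conj k l
  -- `normSq` conjugates the second index, whereas the matrix criterion conjugates the first; hence
  -- the conjugate vector.
  · have h := g.normSq_pos he hz (star_ne_zero.2 hx)
    convert! h using 1
    simp only [dotProduct, Matrix.mulVec, normSq, Finset.mul_sum, Pi.star_apply, RCLike.star_def,
      Complex.conj_conj]
    exact Finset.sum_congr rfl fun i _ => Finset.sum_congr rfl fun j _ => by ring

open scoped ComplexOrder in
theorem det_coeff_mem_slitPlane [IsManifold 𝓘(ℂ, Model n) ω M] (he : e ∈ holomorphicCharts n M)
    (hz : z ∈ e.target) : (g.coeff e z).det ∈ Complex.slitPlane :=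
  Or.inl (Complex.lt_def.1 (g.posDef_coeff he hz).det_pos).1

/-- The first Chern Ricci curvature is the trace of the Chern curvature in its last two indices. -/
theorem chernRicci_eq_trace [IsManifold 𝓘(ℂ, Model n) ω M] (he : e ∈ holomorphicCharts n M)
    (hz : z ∈ e.target) (i j : Fin n) :
    g.chernRicci e z i j = ∑ k, ∑ l, (g.coeff e z)⁻¹ l k * g.chernCurvature e z i j k l := by
  simp only [chernRicci, chernCurvature, invCoeff, delZ_eq_wirt, delZbar_eq_wirt]
  rw [wirt_wirt_log_det e.open_target (g.contDiffOn_coeff he)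
    (fun w hw => g.det_coeff_mem_slitPlane he hw) hz]
  simp only [← Finset.sum_neg_distrib]
  exact Finset.sum_congr rfl fun k _ => Finset.sum_congr rfl fun l _ => by
    rw [← mul_neg, neg_sub, sub_eq_neg_add]

theorem normSq_ne_zero [IsManifold 𝓘(ℂ, Model n) ω M] (he : e ∈ holomorphicCharts n M)
    (hz : z ∈ e.target) {X : Fin n → ℂ} (hX : X ≠ 0) : g.normSq e z X ≠ 0 :=
  open scoped ComplexOrder in (g.normSq_pos he hz hX).ne'

/-- A Chern Kähler-like metric of constant mixed curvature has, at every point, a curvature tensor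
which is determined by its metric and its Ricci curvature. -/
theorem polarized_mixedCurvature [IsManifold 𝓘(ℂ, Model n) ω M] {α β c : ℝ}
    (hlike : g.IsKahlerLike) (hmixed : g.HasConstantMixedCurvature α β c)
    (he : e ∈ holomorphicCharts n M) (hz : z ∈ e.target) (i j k l : Fin n) :
    4 * β * g.chernCurvature e z i j k l
      + α * (g.chernRicci e z i j * g.coeff e z k l + g.chernRicci e z k l * g.coeff e z i j
        + g.chernRicci e z i l * g.coeff e z k j + g.chernRicci e z k j * g.coeff e z i l)
      - 2 * c * (g.coeff e z i j * g.coeff e z k l + g.coeff e z i l * g.coeff e z k j) = 0 := by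
  set R := g.chernCurvature e z
  set S := g.chernRicci e z
  set G : Fin n → Fin n → ℂ := g.coeff e z
  -- Four placements of `Ric ⊗ g` and two of `g ⊗ g` restore the symmetries without using any of
  -- `Ric`; on the diagonal this is four times the cleared hypothesis.
  refine eq_zero_of_quarticForm_diag (T := fun i j k l => 4 * β * R i j k l
      + α * (S i j * G k l + S k l * G i j + S i l * G k j + S k j * G i l)
      - 2 * c * (G i j * G k l + G i l * G k j)) ?_ ?_ ?_ i j k l
  · intro i j k l
    simp only [R, (hlike e he z hz i j k l).1]
    ring
  · intro i j k l
    simp only [R, (hlike e he z hz i j k l).2]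
    ring
  · intro X
    have hprod (A B : Fin n → Fin n → ℂ) (X : Fin n → ℂ) :
        quarticForm (fun i j k l => A i j * B k l) X X X X
          = (∑ i, ∑ j, A i j * X i * conj (X j)) * ∑ i, ∑ j, B i j * X i * conj (X j) := by
      simp only [quarticForm, Finset.sum_mul]
      simp only [Finset.mul_sum]
      exact Finset.sum_congr rfl fun i _ => Finset.sum_congr rfl fun j _ =>
        Finset.sum_congr rfl fun k _ => Finset.sum_congr rfl fun l _ => by ring
    have hprod' (A B : Fin n → Fin n → ℂ) (X : Fin n → ℂ) :
        quarticForm (fun i j k l => A i l * B k j) X X X X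
          = (∑ i, ∑ j, A i j * X i * conj (X j)) * ∑ i, ∑ j, B i j * X i * conj (X j) := by
      rw [quarticForm_swap₂₄, hprod]
    have hlin : quarticForm (fun i j k l => 4 * β * R i j k l
        + α * (S i j * G k l + S k l * G i j + S i l * G k j + S k j * G i l)
        - 2 * c * (G i j * G k l + G i l * G k j)) X X X X
        = 4 * β * quarticForm R X X X X
          + α * (quarticForm (fun i j k l => S i j * G k l) X X X X
            + quarticForm (fun i j k l => G i j * S k l) X X X X
            + quarticForm (fun i j k l => S i l * G k j) X X X X
            + quarticForm (fun i j k l => G i l * S k j) X X X X)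
          - 2 * c * (quarticForm (fun i j k l => G i j * G k l) X X X X
            + quarticForm (fun i j k l => G i l * G k j) X X X X) := by
      simp only [quarticForm, Finset.mul_sum, ← Finset.sum_add_distrib, ← Finset.sum_sub_distrib]
      exact Finset.sum_congr rfl fun i _ => Finset.sum_congr rfl fun j _ =>
        Finset.sum_congr rfl fun k _ => Finset.sum_congr rfl fun l _ => by ring
    rw [hlin, hprod, hprod, hprod, hprod', hprod', hprod']
    by_cases hX : X = 0
    · subst hX
      simp [quarticForm]
    · have hN : g.normSq e z X ≠ 0 := g.normSq_ne_zero he hz hX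
      have h := hmixed e he z hz X hX
      simp only [mixedCurvature, holSectional] at h
      change α / g.normSq e z X * (∑ i, ∑ j, S i j * X i * conj (X j))
        + β * (quarticForm R X X X X / g.normSq e z X ^ 2) = c at h
      change 4 * β * quarticForm R X X X X
        + α * ((∑ i, ∑ j, S i j * X i * conj (X j)) * g.normSq e z X
          + g.normSq e z X * (∑ i, ∑ j, S i j * X i * conj (X j))
          + (∑ i, ∑ j, S i j * X i * conj (X j)) * g.normSq e z X
          + g.normSq e z X * (∑ i, ∑ j, S i j * X i * conj (X j)))
        - 2 * c * (g.normSq e z X * g.normSq e z X + g.normSq e z X * g.normSq e z X) = 0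
      field_simp at h
      linear_combination 4 * h

/-- A Chern Kähler-like metric of constant nonzero mixed curvature is Einstein: its first Chern
Ricci curvature is a nonzero constant multiple of the metric. -/
theorem exists_chernRicci_eq_smul [IsManifold 𝓘(ℂ, Model n) ω M] {α β c : ℝ}
    (hlike : g.IsKahlerLike) (hmixed : g.HasConstantMixedCurvature α β c) (hc : c ≠ 0)
    (hαβ : ((n : ℝ) + 2) * α + 4 * β ≠ 0) :
    ∃ lam : ℂ, lam ≠ 0 ∧ ∀ e ∈ holomorphicCharts n M, ∀ z ∈ e.target, ∀ i j : Fin n,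
      g.chernRicci e z i j = lam * g.coeff e z i j := by
  have hK : ((n : ℂ) + 2) * α + 4 * β ≠ 0 := by exact_mod_cast hαβ
  have hc1 : (2 * c * (n + 1) : ℂ) ≠ 0 := by
    have : (c : ℂ) ≠ 0 := by exact_mod_cast hc
    have : (n + 1 : ℂ) ≠ 0 := by exact_mod_cast n.succ_ne_zero
    exact mul_ne_zero (mul_ne_zero two_ne_zero ‹_›) ‹_›
  -- Here `mu` may depend on the chart and point, but its equation does not.
  have pointwise : ∀ e ∈ holomorphicCharts n M, ∀ z ∈ e.target, ∃ mu : ℂ,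
      (2 * (n + 1) * α + 4 * β) * mu = 2 * c * (n + 1) ∧
      ∀ i j : Fin n, g.chernRicci e z i j = mu * g.coeff e z i j := by
    intro e he z hz
    have hunit : IsUnit (g.coeff e z).det :=
      (Complex.slitPlane_ne_zero (g.det_coeff_mem_slitPlane he hz)).isUnit
    have htr := g.chernRicci_eq_trace he hz
    have hpol := g.polarized_mixedCurvature hlike hmixed he hz
    set R := g.chernCurvature e z
    set S : Matrix (Fin n) (Fin n) ℂ := Matrix.of (g.chernRicci e z) with hS
    set G := g.coeff e z
    set s : ℂ := ∑ k, ∑ l, G⁻¹ l k * S k l with hs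
    -- the contractions of the inverse matrix
    have c1 : ∑ k, ∑ l, G⁻¹ l k * G k l = n := by
      have : (G⁻¹ * G).trace = n := by rw [Matrix.nonsing_inv_mul _ hunit]; simp
      rw [← this, Finset.sum_comm]
      rfl
    have c2 (A : Matrix (Fin n) (Fin n) ℂ) (i j : Fin n) :
        ∑ k, ∑ l, G⁻¹ l k * (A i l * G k j) = A i j := by
      have : (A * (G⁻¹ * G)) i j = A i j := by rw [Matrix.nonsing_inv_mul _ hunit, mul_one]
      rw [← this, Finset.sum_comm]
      simp only [Matrix.mul_apply, Finset.mul_sum]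
      exact Finset.sum_congr rfl fun i _ => Finset.sum_congr rfl fun j _ => by ring
    have c3 (A : Matrix (Fin n) (Fin n) ℂ) (i j : Fin n) :
        ∑ k, ∑ l, G⁻¹ l k * (A k j * G i l) = A i j := by
      have : (G * G⁻¹ * A) i j = A i j := by rw [Matrix.mul_nonsing_inv _ hunit, one_mul]
      rw [← this]
      simp only [Matrix.mul_apply, Finset.sum_mul]
      exact Finset.sum_congr rfl fun i _ => Finset.sum_congr rfl fun j _ => by ring
    -- Contract with `g^{k l̄}`: the four Ricci terms give `n S`, `s G`, `S` and `S`, the two metric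
    -- terms `n G` and `G`.
    have traced (i j : Fin n) :
        4 * β * S i j + α * (n * S i j + s * G i j + 2 * S i j) - 2 * c * (n + 1) * G i j = 0 := by
      have h0 : ∑ k, ∑ l, G⁻¹ l k * (4 * β * R i j k l
          + α * (S i j * G k l + S k l * G i j + S i l * G k j + S k j * G i l)
          - 2 * c * (G i j * G k l + G i l * G k j)) = 0 :=
        Finset.sum_eq_zero fun k _ => Finset.sum_eq_zero fun l _ => 
          mul_eq_zero_of_right _ (hpol i j k l)
      have h1 : ∑ k, ∑ l, G⁻¹ l k * (4 * β * R i j k l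
          + α * (S i j * G k l + S k l * G i j + S i l * G k j + S k j * G i l)
          - 2 * c * (G i j * G k l + G i l * G k j))
          = 4 * β * (∑ k, ∑ l, G⁻¹ l k * R i j k l)
            + α * (S i j * (∑ k, ∑ l, G⁻¹ l k * G k l) + (∑ k, ∑ l, G⁻¹ l k * S k l) * G i j
              + (∑ k, ∑ l, G⁻¹ l k * (S i l * G k j)) + (∑ k, ∑ l, G⁻¹ l k * (S k j * G i l)))
            - 2 * c * (G i j * (∑ k, ∑ l, G⁻¹ l k * G k l)
              + ∑ k, ∑ l, G⁻¹ l k * (G i l * G k j)) := by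
        simp only [Finset.mul_sum, Finset.sum_mul, ← Finset.sum_add_distrib,
          ← Finset.sum_sub_distrib]
        exact Finset.sum_congr rfl fun k _ => Finset.sum_congr rfl fun l _ => by ring
      rw [h1, ← htr, c1, c2, c2, c3, ← hs] at h0
      change 4 * β * S i j + _ - _ = 0 at h0
      linear_combination h0
    set mu : ℂ := (2 * c * (n + 1) - α * s) / ((n + 2) * α + 4 * β) with hmu
    have hmuK : mu * ((n + 2) * α + 4 * β) = 2 * c * (n + 1) - α * s := div_mul_cancel₀ _ hK
    have hSG (i j : Fin n) : S i j = mu * G i j := by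
      apply mul_right_cancel₀ hK
      linear_combination traced i j - G i j * hmuK
    refine ⟨mu, ?_, hSG⟩
    -- The second trace eliminates `s`.
    have hsn : s = n * mu := by
      rw [hs, ← c1, Finset.sum_mul]
      refine Finset.sum_congr rfl fun k _ => ?_
      rw [Finset.sum_mul]
      exact Finset.sum_congr rfl fun l _ => by rw [hSG]; ring
    rw [hsn] at hmuK
    linear_combination hmuK
  by_cases hne : (2 * (n + 1) * α + 4 * β : ℂ) = 0
  -- In this case no chart has a point in its target, so any nonzero constant serves.
  · refine ⟨1, one_ne_zero, fun e he z hz => ?_⟩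
    obtain ⟨mu, h, -⟩ := pointwise e he z hz
    rw [hne, zero_mul] at h
    exact absurd h.symm hc1
  · refine ⟨2 * c * (n + 1) / (2 * (n + 1) * α + 4 * β), div_ne_zero hc1 hne,
      fun e he z hz i j => ?_⟩
    obtain ⟨mu, h, h'⟩ := pointwise e he z hz
    rw [h' i j, ← h, mul_div_cancel_left₀ _ hne]

end HermitianMetric

end Metric

/-! ### Closedness of a (1,1)-form from its coefficients. -/

section Closed

variable {n : ℕ}

/-- The differential of a function in terms of its Wirtinger derivatives. -/
theorem fderiv_eq_sum_wirtinger (f : Model n → ℂ) (z v : Model n) :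
    fderiv ℝ f z v = ∑ k, (delZ k f z * v k + delZbar k f z * conj (v k)) := by
  have hv : v = ∑ k, ((v k).re • basisVec k + (v k).im • (Complex.I • basisVec k) : Model n) := by
    ext i
    simp [basisVec, Pi.single_apply, Finset.sum_add_distrib, Complex.re_add_im]
  conv_lhs => rw [hv]
  simp only [map_sum, map_add, map_smul, Complex.real_smul]
  refine Finset.sum_congr rfl fun k _ => ?_
  have hI := Complex.I_sq
  have h1 : conj (v k) = (v k).re - (v k).im * Complex.I := by
    apply Complex.ext <;> simp
  simp only [delZ, delZbar]
  rw [h1]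
  nth_rw 3 [← Complex.re_add_im (v k)]
  linear_combination ((v k).im * fderiv ℝ f z (Complex.I • basisVec k)) * hI

/-- The form `√-1 ∑ h_{i j̄} dzⁱ ∧ dz̄ʲ` is closed when the derivatives of its coefficients have
the Kähler symmetries. -/
theorem extDeriv_sum_smul_wedge_eq_zero {h : Model n → Matrix (Fin n) (Fin n) ℂ} {z : Model n}
    (hd : ∀ i j, DifferentiableAt ℝ (fun w => h w i j) z)
    (h1 : ∀ i j k, delZ k (fun w => h w i j) z = delZ i (fun w => h w k j) z)
    (h2 : ∀ i j k, delZbar k (fun w => h w i j) z = delZbar j (fun w => h w i k) z) :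
    extDeriv (fun w => ∑ i, ∑ j, (Complex.I * h w i j) • wedge (coordForm i) (coordFormBar j)) z
      = 0 := by
  set Ω : Model n → Model n [⋀^Fin 2]→L[ℝ] ℂ := fun w =>
    ∑ i, ∑ j, (Complex.I * h w i j) • wedge (coordForm i) (coordFormBar j)
  have hterm (i j : Fin n) : HasFDerivAt
      (fun w => (Complex.I * h w i j) • wedge (coordForm i) (coordFormBar j))
      ((Complex.I • fderiv ℝ (fun w => h w i j) z).smulRight
        (wedge (coordForm i) (coordFormBar j))) z := by
    have := (hd i j).hasFDerivAt.const_mul Complex.I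
    have := this.smul_const (wedge (coordForm i) (coordFormBar j))
    exact this
  have hsum : HasFDerivAt Ω _ z := HasFDerivAt.fun_sum (u := Finset.univ) fun i _ =>
    HasFDerivAt.fun_sum (u := Finset.univ) fun j _ => hterm i j
  -- the two contributions, of type `(2,1)` and `(1,2)`
  set A : Model n → Model n → Model n → ℂ := fun x y w =>
    ∑ i, ∑ j, ∑ k, delZ k (fun w => h w i j) z * x k * y i * starRingEnd ℂ (w j) with hA
  set B : Model n → Model n → Model n → ℂ := fun x y w =>
    ∑ i, ∑ j, ∑ k, delZbar k (fun w => h w i j) z * starRingEnd ℂ (x k) * y i * starRingEnd ℂ (w j) with hB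
  have symA (x y w) : A x y w = A y x w := by
    simp only [hA]
    rw [Finset.sum_comm]
    conv_rhs => rw [Finset.sum_comm]
    refine Finset.sum_congr rfl fun j _ => ?_
    rw [Finset.sum_comm]
    exact Finset.sum_congr rfl fun k _ => Finset.sum_congr rfl fun i _ => by rw [h1]; ring
  have symB (x y w) : B x y w = B w y x := by
    simp only [hB]
    refine Finset.sum_congr rfl fun i _ => ?_
    rw [Finset.sum_comm]
    exact Finset.sum_congr rfl fun k _ => Finset.sum_congr rfl fun j _ => by rw [h2]; ring
  have eval (x : Model n) (u : Fin 2 → Model n) :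
      fderiv ℝ Ω z x u
        = Complex.I * (A x (u 0) (u 1) - A x (u 1) (u 0) + B x (u 0) (u 1) - B x (u 1) (u 0)) := by
    rw [hsum.fderiv]
    simp only [hA, hB, _root_.sum_apply, ContinuousLinearMap.smulRight_apply,
      ContinuousAlternatingMap.sum_apply, ContinuousAlternatingMap.smul_apply, wedge_apply,
      ← Finset.sum_add_distrib, ← Finset.sum_sub_distrib, Finset.mul_sum]
    refine Finset.sum_congr rfl fun i _ => Finset.sum_congr rfl fun j _ => ?_
    simp only [_root_.smul_apply, smul_eq_mul, fderiv_eq_sum_wirtinger, Finset.sum_mul,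
      Finset.mul_sum]
    refine Finset.sum_congr rfl fun k _ => ?_
    simp only [coordForm, coordFormBar, ContinuousLinearMap.comp_apply,
      ContinuousLinearMap.coe_restrictScalars', PiLp.proj_apply,
      ContinuousLinearEquiv.coe_coe, Complex.conjCLE_apply]
    ring
  ext v
  -- In the alternating sum the `A` terms cancel by exchanging the first two arguments, the `B`
  -- terms by exchanging the first and third.
  rw [extDeriv, ContinuousAlternatingMap.alternatizeUncurryFin_apply]
  rw [Fin.sum_univ_three, eval, eval, eval]
  simp [Fin.removeNth, Fin.succAbove]
  rw [symA (v 1) (v 0), symA (v 2) (v 0), symA (v 2) (v 1), symB (v 1) (v 0) (v 2),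
    symB (v 0) (v 2) (v 1), symB (v 0) (v 1) (v 2)]
  ring

end Closed

/-! ### From Einstein to Kähler. -/

namespace HermitianMetric

variable {n : ℕ} {M : Type*} [TopologicalSpace M] [ChartedSpace (Model n) M]
  (g : HermitianMetric n M)

/-- A Hermitian metric whose first Chern Ricci curvature is a nonzero constant multiple of the
metric is Kähler. -/
theorem isKahler_of_chernRicci_eq_smul [IsManifold 𝓘(ℂ, Model n) ω M] {lam : ℂ} (hlam : lam ≠ 0)
    (h : ∀ e ∈ holomorphicCharts n M, ∀ z ∈ e.target, ∀ i j : Fin n,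
      g.chernRicci e z i j = lam * g.coeff e z i j) : g.IsKahler := by
  intro e he z hz
  have hU := e.open_target
  have hlog : ContDiffOn ℝ ∞ (fun w => Complex.log (g.coeff e w).det) e.target := by
    intro w hw
    have h1 : ContDiffAt ℝ ∞ Complex.log (g.coeff e w).det :=
      (Complex.contDiffAt_log (g.det_coeff_mem_slitPlane he hw)).restrict_scalars ℝ
    exact h1.comp_contDiffWithinAt w (contDiffOn_det (g.contDiffOn_coeff he) w hw)
  set L := fun w => Complex.log (g.coeff e w).det
  -- `-lam⁻¹ log det g` is a local potential, so derivatives of the coefficients are third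
  -- derivatives of one function and inherit their symmetries.
  have hcoeff (i j : Fin n) :
      Set.EqOn (fun w => g.coeff e w i j) (fun w => -lam⁻¹ * delZ i (delZbar j L) w) e.target := by
    intro w hw
    have h2 := h e he w hw i j
    simp only [chernRicci] at h2
    simp only
    rw [neg_mul, ← mul_neg, h2, inv_mul_cancel_left₀ hlam]
  have hsm (j : Fin n) : ContDiffOn ℝ ∞ (delZbar j L) e.target := contDiffOn_wirt hU hlog
  have hdiff {f : Model n → ℂ} (hf : ContDiffOn ℝ ∞ f e.target) : DifferentiableAt ℝ f z :=
    (hf.contDiffAt (hU.mem_nhds hz)).differentiableAt (by simp)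
  simp only [delZ_eq_wirt, delZbar_eq_wirt] at hcoeff hsm
  refine extDeriv_sum_smul_wedge_eq_zero (fun i j => hdiff (g.contDiffOn_coeff he i j)) ?_ ?_
  · intro i j k
    simp only [delZ_eq_wirt]
    rw [wirt_congr hU hz (hcoeff i j), wirt_congr hU hz (hcoeff k j),
      wirt_const_mul _ (hdiff (contDiffOn_wirt hU (hsm j))),
      wirt_const_mul _ (hdiff (contDiffOn_wirt hU (hsm j))), wirt_comm hU (hsm j) hz]
  -- The outer `∂̄` must first move past `∂ᵢ`; the two `∂̄` then commute inside it.
  · intro i j k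
    simp only [delZbar_eq_wirt]
    rw [wirt_congr hU hz (hcoeff i j), wirt_congr hU hz (hcoeff i k),
      wirt_const_mul _ (hdiff (contDiffOn_wirt hU (hsm j))),
      wirt_const_mul _ (hdiff (contDiffOn_wirt hU (hsm k))), wirt_comm hU (hsm j) hz,
      wirt_comm hU (hsm k) hz, wirt_congr hU hz fun w hw => wirt_comm hU hlog hw]

end HermitianMetric

end HermitianGeometry

theorem mainTheorem4 {n : ℕ} {M : Type*} [TopologicalSpace M]
    [ChartedSpace (HermitianGeometry.Model n) M]
    [IsManifold 𝓘(ℂ, HermitianGeometry.Model n) ω M]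
    (g : HermitianGeometry.HermitianMetric n M) (α β c : ℝ)
    (hlike : g.IsKahlerLike)
    (hmixed : g.HasConstantMixedCurvature α β c) (hc : c ≠ 0)
    (hαβ : ((n : ℝ) + 2) * α + 4 * β ≠ 0) :
    g.IsKahler := by
  obtain ⟨lam, hlam, h⟩ := g.exists_chernRicci_eq_smul hlike hmixed hc hαβ
  exact g.isKahler_of_chernRicci_eq_smul hlam h
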